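/- Let $n \ge 0$ be an integer and let $s \in (0,\pi)$. Let $R(t) = \sum_{k=-n}^{n} c_k e^{ikt}$, $t \in \mathbb{R}$, be a trigonometric polynomial of degree at most $n$ with complex coefficients $c_k$ such that $$m(\{t \in [-\pi,\pi] : |R(t)| \le 1\}) \ge 2\pi - s,$$ where $m$ denotes Lebesgue measure. Then $$\max_{t \in \mathbb{R}} |R(t)| \le T_{2n}(\sec(s/2)) = \tfrac12\Big((\sec(s/2)+\tan(s/2))^{2n} + (\sec(s/2)-\tan(s/2))^{2n}\Big),$$ where $T_{2n}$ is the Chebyshev polynomial of degree $2n$, defined by $T_{2n}(\cos t) = \cos(2nt)$ for $t \in \mathbb{R}$. -/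

import Mathlib

open MeasureTheory

/-- The set `𝒯ₙᶜ` of all complex trigonometric polynomials of degree at most `n`, viewed as
(`2π`-periodic) functions on the real line: `R(t) = ∑_{|k| ≤ n} c_k e^{ikt}`, `c_k ∈ ℂ`. -/
def complexTrigPoly (n : ℕ) : Set (ℝ → ℂ) :=
  {R | ∃ c : ℤ → ℂ, ∀ t : ℝ,
    R t = ∑ k ∈ Finset.Icc (-(n : ℤ)) (n : ℤ), c k * Complex.exp ((k : ℂ) * (t : ℂ) * Complex.I)}

/-- The set `𝒯ₙᶜ(s)` of all `R ∈ 𝒯ₙᶜ` for which the set of `t` in a period, here `[-π, π]`, with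
`|R(t)| ≤ 1` has Lebesgue measure at least `2π - s`. -/
def complexTrigPolyRemez (n : ℕ) (s : ℝ) : Set (ℝ → ℂ) :=
  {R | R ∈ complexTrigPoly n ∧
    ENNReal.ofReal (2 * Real.pi - s) ≤
      volume {t : ℝ | t ∈ Set.Icc (-Real.pi) Real.pi ∧ ‖R t‖ ≤ 1}}

/-- The secant. -/
noncomputable def realSec (x : ℝ) : ℝ := 1 / Real.cos x

/-! Fix `t₀`. The even part of `R` about `t₀` is `P (cos x)` with `P` of degree at most `n` and `P 1
= R t₀`. It is bounded by 1 on the set `A` of those `x` in `[0, π]` for which `t₀ + x` and `t₀ - x`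
are both good, and `A` has measure at least `π - s`.

It remains to bound `P 1`. The extremal configuration is `A = [s, π]`, where the Chebyshev points of
`[-1, cos s]` are the best nodes. For general `A`, `exists_pushforward_right` carries these nodes,
as angles, into `A`, moving them towards 0 without shrinking gaps. By `lagrange_factor_le` this
decreases the modulus of every factor of every Lagrange basis polynomial at 1. For the Chebyshev
nodes the sum of these moduli is exactly a value of `T n` (`eval_T_eq_sum_prod_abs`), and `T 2n = T
n ∘ T 2` puts it in the stated form. -/

open Polynomial in
/-- Lagrange interpolation at `n + 1` distinct nodes, written out. -/
theorem eval_eq_sum_prod_lagrange {F : Type*} [Field F] {n : ℕ} {v : ℕ → F}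
    (hv : Set.InjOn v (Finset.range (n + 1))) {P : F[X]} (hP : P.degree ≤ n) (x : F) :
    P.eval x = ∑ i ∈ Finset.range (n + 1), P.eval (v i) *
      ∏ j ∈ (Finset.range (n + 1)).erase i, (x - v j) / (v i - v j) := by
  have hP' : P.degree < (Finset.range (n + 1)).card := by
    rw [Finset.card_range]
    exact hP.trans_lt (by exact_mod_cast Nat.lt_succ_self n)
  conv_lhs => rw [Lagrange.eq_interpolate hv hP']
  simp only [Lagrange.interpolate_apply, eval_finsetSum, eval_mul, eval_C, Lagrange.basis,
    eval_prod, Lagrange.basisDivisor, eval_sub, eval_X]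
  refine Finset.sum_congr rfl fun i _ => congrArg _ (Finset.prod_congr rfl fun j _ => ?_)
  rw [div_eq_mul_inv, mul_comm]

open Polynomial Polynomial.Chebyshev in
/-- Outside `[-1, 1]` the Chebyshev polynomial is the Lebesgue function of its extremal points. -/
theorem eval_T_eq_sum_prod_abs (n : ℕ) {x : ℝ} (hx : 1 ≤ x) :
    (T ℝ n).eval x = ∑ i ∈ Finset.range (n + 1),
      ∏ j ∈ (Finset.range (n + 1)).erase i, |x - node n j| / |node n i - node n j| := by
  rw [eval_eq_sum_prod_lagrange (strictAntiOn_node n).injOn (P := T ℝ n) (by simp) x]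
  refine Finset.sum_congr rfl fun i hi => ?_
  have hi' : i ≤ n := Nat.lt_succ_iff.mp (Finset.mem_range.mp hi)
  rw [eval_T_real_node (Finset.mem_Iic.mpr hi'), Finset.prod_div_distrib, Finset.prod_div_distrib,
    ← Finset.abs_prod (f := fun j => node n i - node n j)]
  -- The denominator has sign `(-1) ^ i`, which is also the value of `T n` at the node, so the signs
  -- cancel.
  have h1 := zero_lt_prod_node_sub_node hi'
  have h2 : ∏ j ∈ (Finset.range (n + 1)).erase i, |x - node n j| =
      ∏ j ∈ (Finset.range (n + 1)).erase i, (x - node n j) :=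
    Finset.prod_congr rfl fun j _ =>
      abs_of_nonneg (by linarith [(node_mem_Icc (n := n) (i := j)).2])
  have h3 := abs_of_pos h1
  rw [abs_mul, abs_neg_one_pow, one_mul] at h3
  rw [h2, h3]
  rcases neg_one_pow_eq_or ℝ i with h | h <;> simp [h, div_neg]

/-! ### Comparison of nodes and transport into the good set -/

/-- Moving two points of `[0, π]` towards `0` while increasing their distance decreases the
ratio of the distances from `1` of their cosines. -/
theorem one_sub_cos_mul_le {a b a' b' : ℝ} (ha : 0 ≤ a) (haa : a ≤ a') (hab : a' ≤ b')
    (hb' : b' ≤ Real.pi) (hb : b ≤ Real.pi) (hd : b' - a' ≤ b - a) :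
    (1 - Real.cos a) * (1 - Real.cos b') ≤ (1 - Real.cos a') * (1 - Real.cos b) := by
  have half : ∀ x : ℝ, 1 - Real.cos x = 2 * Real.sin (x / 2) ^ 2 := fun x => by
    have := Real.cos_sq (x / 2)
    have h := Real.sin_sq_add_cos_sq (x / 2)
    rw [mul_div_cancel₀ x two_ne_zero] at this
    linarith
  have key : Real.sin (a / 2) * Real.sin (b' / 2) ≤ Real.sin (a' / 2) * Real.sin (b / 2) := by
    have h1 : Real.sin (a / 2 + (b' / 2 - a' / 2)) ≤ Real.sin (b / 2) :=
      Real.sin_le_sin_of_le_of_le_pi_div_two (by linarith [Real.pi_pos]) (by linarith)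
        (by linarith)
    have h2 : 0 ≤ Real.sin (a' / 2) :=
      Real.sin_nonneg_of_nonneg_of_le_pi (by linarith) (by linarith)
    have h3 : 0 ≤ Real.sin (b' / 2 - a' / 2) :=
      Real.sin_nonneg_of_nonneg_of_le_pi (by linarith) (by linarith)
    have h4 : 0 ≤ Real.sin (a' / 2 - a / 2) :=
      Real.sin_nonneg_of_nonneg_of_le_pi (by linarith) (by linarith)
    have h5 : Real.sin (a' / 2) * Real.sin (a / 2 + (b' / 2 - a' / 2)) -
        Real.sin (a / 2) * Real.sin (b' / 2) =
        Real.sin (b' / 2 - a' / 2) * Real.sin (a' / 2 - a / 2) := by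
      have : b' / 2 = a' / 2 + (b' / 2 - a' / 2) := by ring
      generalize b' / 2 - a' / 2 = δ at this
      rw [this, Real.sin_add, Real.sin_add, Real.sin_sub]
      ring
    nlinarith [mul_le_mul_of_nonneg_left h1 h2, mul_nonneg h3 h4]
  have h0 : 0 ≤ Real.sin (a / 2) * Real.sin (b' / 2) :=
    mul_nonneg (Real.sin_nonneg_of_nonneg_of_le_pi (by linarith) (by linarith))
      (Real.sin_nonneg_of_nonneg_of_le_pi (by linarith) (by linarith))
  have := pow_le_pow_left₀ h0 key 2
  rw [half, half, half, half]
  nlinarith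

/-- Comparison of the two factors of Lagrange basis polynomials at `1` that come from a pair of
nodes. -/
theorem lagrange_factor_le {a b a' b' : ℝ} (ha : 0 ≤ a) (haa : a ≤ a') (hab : a' < b')
    (hb' : b' ≤ Real.pi) (hb : b ≤ Real.pi) (hd : b' - a' ≤ b - a) :
    |1 - Real.cos a| / |Real.cos b - Real.cos a| ≤
        |1 - Real.cos a'| / |Real.cos b' - Real.cos a'| ∧
      |1 - Real.cos b| / |Real.cos a - Real.cos b| ≤
        |1 - Real.cos b'| / |Real.cos a' - Real.cos b'| := by
  have key := one_sub_cos_mul_le ha haa hab.le hb' hb hd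
  have h1 : Real.cos b < Real.cos a := Real.cos_lt_cos_of_nonneg_of_le_pi ha hb (by linarith)
  have h2 : Real.cos b' < Real.cos a' :=
    Real.cos_lt_cos_of_nonneg_of_le_pi (by linarith) hb' (by linarith)
  have pos : ∀ x : ℝ, |1 - Real.cos x| = 1 - Real.cos x := fun x =>
    abs_of_nonneg (by linarith [Real.cos_le_one x])
  rw [pos, pos, pos, pos, abs_sub_comm (Real.cos b), abs_sub_comm (Real.cos b'),
    abs_of_pos (sub_pos.mpr h1), abs_of_pos (sub_pos.mpr h2),
    div_le_div_iff₀ (sub_pos.mpr h1) (sub_pos.mpr h2),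
    div_le_div_iff₀ (sub_pos.mpr h1) (sub_pos.mpr h2)]
  -- After cross-multiplication and cancellation of a common product, both inequalities reduce to
  -- `key`.
  constructor <;> linarith

/-- Mass transport of a compact subset of `[0, π]` towards `π`. -/
theorem exists_pushforward_right {A : Set ℝ} (hA : IsClosed A) (hAπ : A ⊆ Set.Icc 0 Real.pi)
    {s : ℝ} (hs : s < Real.pi) (hvol : Real.pi - s ≤ volume.real A) :
    ∃ θ : ℝ → ℝ, (∀ τ ∈ Set.Icc s Real.pi, θ τ ∈ A ∧ θ τ ≤ τ) ∧
      ∀ τ ∈ Set.Icc s Real.pi, ∀ τ' ∈ Set.Icc s Real.pi, τ < τ' → τ' - τ ≤ θ τ' - θ τ := by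
  -- `θ τ` will be a point of `A` with exactly as much of `A` to its right as `[τ, π]` has length.
  -- Since `h` is antitone and 1-Lipschitz, gaps cannot shrink.
  set h : ℝ → ℝ := fun x => volume.real (A ∩ Set.Icc x Real.pi) with hh
  have hfin : volume A ≠ ⊤ := ((measure_mono hAπ).trans_lt measure_Icc_lt_top).ne
  have hanti : Antitone h := fun x y hxy =>
    measureReal_mono (Set.inter_subset_inter_right _ (Set.Icc_subset_Icc_left hxy))
      (measure_ne_top_of_subset Set.inter_subset_left hfin)
  have hstep : ∀ x y, x ≤ y → h x ≤ h y + (y - x) := fun x y hxy => by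
    have hsub : A ∩ Set.Icc x Real.pi ⊆ (A ∩ Set.Icc y Real.pi) ∪ Set.Icc x y := by
      rintro z ⟨hz, hz1, hz2⟩
      rcases le_total y z with h' | h'
      · exact Or.inl ⟨hz, h', hz2⟩
      · exact Or.inr ⟨hz1, h'⟩
    calc h x ≤ volume.real ((A ∩ Set.Icc y Real.pi) ∪ Set.Icc x y) :=
          measureReal_mono hsub (measure_union_ne_top
            (measure_ne_top_of_subset Set.inter_subset_left hfin) measure_Icc_lt_top.ne)
      _ ≤ h y + volume.real (Set.Icc x y) := measureReal_union_le _ _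
      _ = h y + (y - x) := by rw [Real.volume_real_Icc_of_le hxy]
  have hcont : Continuous h := by
    refine (LipschitzWith.of_le_add fun x y => ?_).continuous
    rcases le_total x y with hxy | hxy
    · rw [Real.dist_eq, abs_sub_comm, abs_of_nonneg (sub_nonneg.mpr hxy)]
      exact hstep x y hxy
    · exact (hanti hxy).trans (le_add_of_nonneg_right dist_nonneg)
  have hAc : IsCompact A := isCompact_Icc.of_isClosed_subset hA hAπ
  have hex : ∀ τ ∈ Set.Icc s Real.pi, ∃ x ∈ A, h x = Real.pi - τ := by
    intro τ hτ
    have hAne : A.Nonempty := by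
      rw [Set.nonempty_iff_ne_empty]
      rintro rfl
      simp at hvol
      linarith
    have hKc : IsCompact (A ∩ {x | Real.pi - τ ≤ h x}) :=
      hAc.inter_right (isClosed_le continuous_const hcont)
    have hKne : (A ∩ {x | Real.pi - τ ≤ h x}).Nonempty := by
      obtain ⟨m, hm, hmin⟩ := hAc.exists_isLeast hAne
      refine ⟨m, hm, ?_⟩
      have : A ∩ Set.Icc m Real.pi = A :=
        Set.inter_eq_left.mpr fun z hz => ⟨hmin hz, (hAπ hz).2⟩
      simp only [Set.mem_ofPred_eq, hh, this]
      linarith [hτ.1]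
    obtain ⟨x, ⟨hxA, hx⟩, hmax⟩ := hKc.exists_isGreatest hKne
    refine ⟨x, hxA, le_antisymm (not_lt.mp fun hlt => ?_) hx⟩
    -- Half the excess keeps `h y` above `π - τ`; the first point of `A` from `y` on then
    -- contradicts the maximality of `x`.
    set y := x + (h x - (Real.pi - τ)) / 2 with hy
    have hxy : x < y := by linarith
    have hyh : Real.pi - τ < h y := by linarith [hstep x y hxy.le]
    have hne : (A ∩ Set.Icc y Real.pi).Nonempty := by
      rw [Set.nonempty_iff_ne_empty]
      intro he
      have : h y = 0 := by simp only [hh, he, measureReal_empty]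
      linarith [hτ.2]
    obtain ⟨m, ⟨hmA, hm⟩, hmin⟩ := (hAc.inter_right isClosed_Icc).exists_isLeast hne
    have hmh : h y ≤ h m := measureReal_mono
      (fun z hz => ⟨hz.1, hmin hz, hz.2.2⟩)
      (measure_ne_top_of_subset Set.inter_subset_left hfin)
    have := hmax ⟨hmA, (hyh.le.trans hmh : Real.pi - τ ≤ h m)⟩
    linarith [hm.1]
  choose! θ hθA hθ using hex
  refine ⟨θ, fun τ hτ => ⟨hθA τ hτ, ?_⟩, fun τ hτ τ' hτ' hlt => ?_⟩
  · have h1 := hθ τ hτ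
    have h2 := hstep (θ τ) Real.pi (hAπ (hθA τ hτ)).2
    have h3 : h Real.pi = 0 := by
      refine le_antisymm ?_ measureReal_nonneg
      calc h Real.pi ≤ volume.real (Set.Icc Real.pi Real.pi) :=
            measureReal_mono Set.inter_subset_right measure_Icc_lt_top.ne
        _ = 0 := by rw [Real.volume_real_Icc_of_le le_rfl, sub_self]
    linarith
  · have h1 := hθ τ hτ
    have h2 := hθ τ' hτ'
    have hle : θ τ ≤ θ τ' := by
      by_contra hc
      linarith [hanti (not_le.mp hc).le]
    linarith [hstep _ _ hle]

open Polynomial Polynomial.Chebyshev in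
/-- The Remez inequality at the endpoint `1`, for a polynomial in `cos θ`. -/
theorem norm_eval_one_le_of_measure {n : ℕ} {P : ℂ[X]} (hP : P.degree ≤ n) {A : Set ℝ}
    (hA : IsClosed A) (hAπ : A ⊆ Set.Icc 0 Real.pi) {s : ℝ} (hs : s ∈ Set.Ioo 0 Real.pi)
    (hvol : Real.pi - s ≤ volume.real A) (hPA : ∀ x ∈ A, ‖P.eval (Real.cos x : ℂ)‖ ≤ 1) :
    ‖P.eval 1‖ ≤ (T ℝ n).eval (2 * (1 / Real.cos (s / 2)) ^ 2 - 1) := by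
  obtain ⟨θ, hθ, hθd⟩ := exists_pushforward_right hA hAπ hs.2 hvol
  set c := Real.cos (s / 2) with hc
  have hc0 : 0 < c := Real.cos_pos_of_mem_Ioo ⟨by linarith [hs.1, Real.pi_pos], by linarith [hs.2]⟩
  have hc1 : c ≤ 1 := Real.cos_le_one _
  have hcs : 2 * c ^ 2 - 1 = Real.cos s := by
    rw [hc, ← Real.cos_two_mul]
    congr 1
    ring
  -- The affine map `u ↦ c ^ 2 * (1 + u) - 1` takes `[-1, 1]` to `[-1, cos s]` and `2 / c ^ 2 - 1`
  -- to 1.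
  set τ : ℕ → ℝ := fun i => Real.arccos (c ^ 2 * (1 + node n i) - 1) with hτ
  have hnode : ∀ i, node n i ∈ Set.Icc (-1 : ℝ) 1 := fun i => node_mem_Icc
  have hlow : ∀ i, -1 ≤ c ^ 2 * (1 + node n i) - 1 := fun i => by
    have := mul_nonneg (sq_nonneg c) (show 0 ≤ 1 + node n i by linarith [(hnode i).1])
    linarith
  have hup : ∀ i, c ^ 2 * (1 + node n i) - 1 ≤ Real.cos s := fun i => by
    have := mul_le_mul_of_nonneg_left (show 1 + node n i ≤ 2 by linarith [(hnode i).2])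
      (sq_nonneg c)
    linarith
  have hcosτ : ∀ i, Real.cos (τ i) = c ^ 2 * (1 + node n i) - 1 := fun i =>
    Real.cos_arccos (hlow i) ((hup i).trans (Real.cos_le_one _))
  have hτmem : ∀ i, τ i ∈ Set.Icc s Real.pi := fun i =>
    ⟨by rw [← Real.arccos_cos hs.1.le hs.2.le]; exact Real.arccos_le_arccos (hup i),
      Real.arccos_le_pi _⟩
  have hτlt : ∀ i j, i < j → j ≤ n → τ i < τ j := fun i j hij hj => by
    refine Real.arccos_lt_arccos (hlow j) ?_ ((hup i).trans (Real.cos_le_one _))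
    have := mul_lt_mul_of_pos_left (node_lt hj hij) (pow_pos hc0 2)
    linarith
  have hmem : ∀ i, θ (τ i) ∈ A := fun i => (hθ _ (hτmem i)).1
  have hfac : ∀ i j, i ≤ n → j ≤ n → j ≠ i →
      ‖(1 : ℂ) - (Real.cos (θ (τ j)) : ℂ)‖ /
        ‖(Real.cos (θ (τ i)) : ℂ) - (Real.cos (θ (τ j)) : ℂ)‖ ≤
      |2 * (1 / c) ^ 2 - 1 - node n j| / |node n i - node n j| := by
    intro i j hi hj hij
    have e1 : 2 * (1 / c) ^ 2 - 1 - node n j = (1 - Real.cos (τ j)) / c ^ 2 := by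
      rw [hcosτ]
      field_simp
      ring
    have e2 : node n i - node n j = (Real.cos (τ i) - Real.cos (τ j)) / c ^ 2 := by
      rw [hcosτ, hcosτ]
      field_simp
      ring
    rw [e1, e2, abs_div, abs_div, div_div_div_cancel_right₀ (by positivity)]
    rw [← Complex.ofReal_one, ← Complex.ofReal_sub, ← Complex.ofReal_sub, Complex.norm_real,
      Complex.norm_real, Real.norm_eq_abs, Real.norm_eq_abs]
    rcases lt_or_gt_of_ne hij with h | h
    · exact (lagrange_factor_le (hAπ (hmem j)).1 (hθ _ (hτmem j)).2 (hτlt j i h hi)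
        (hτmem i).2 (hAπ (hmem i)).2 (hθd _ (hτmem j) _ (hτmem i) (hτlt j i h hi))).1
    · exact (lagrange_factor_le (hAπ (hmem i)).1 (hθ _ (hτmem i)).2 (hτlt i j h hj)
        (hτmem j).2 (hAπ (hmem j)).2 (hθd _ (hτmem i) _ (hτmem j) (hτlt i j h hj))).2
  have hlt : ∀ i j, i < j → j ≤ n → θ (τ i) < θ (τ j) := fun i j hij hj => by
    linarith [hθd _ (hτmem i) _ (hτmem j) (hτlt i j hij hj), hτlt i j hij hj]
  have hinj : Set.InjOn (fun i => (Real.cos (θ (τ i)) : ℂ)) (Finset.range (n + 1)) := by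
    intro i hi j hj hij
    have hi' : i ≤ n := Nat.lt_succ_iff.mp (Finset.mem_range.mp hi)
    have hj' : j ≤ n := Nat.lt_succ_iff.mp (Finset.mem_range.mp hj)
    have heq := Real.injOn_cos (hAπ (hmem i)) (hAπ (hmem j)) (Complex.ofReal_injective hij)
    rcases lt_trichotomy i j with h | h | h
    · exact absurd heq (hlt i j h hj').ne
    · exact h
    · exact absurd heq (hlt j i h hi').ne'
  have hΛ : 1 ≤ 2 * (1 / c) ^ 2 - 1 := by
    have : 1 ≤ (1 / c) ^ 2 := one_le_pow₀ ((one_le_div hc0).mpr hc1)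
    linarith
  rw [eval_T_eq_sum_prod_abs n hΛ, eval_eq_sum_prod_lagrange hinj hP]
  refine (norm_sum_le _ _).trans (Finset.sum_le_sum fun i hi => ?_)
  rw [norm_mul, norm_prod]
  refine (mul_le_of_le_one_left (Finset.prod_nonneg fun _ _ => norm_nonneg _)
    (hPA _ (hmem i))).trans (Finset.prod_le_prod (fun _ _ => norm_nonneg _) fun j hj => ?_)
  rw [norm_div]
  rw [Finset.mem_erase, Finset.mem_range, Nat.lt_succ_iff] at hj
  exact hfac i j (Nat.lt_succ_iff.mp (Finset.mem_range.mp hi)) hj.2 hj.1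

/-! ### Symmetrization about a point -/

/-- The part of a `p`-periodic set in an interval of length `p` has measure independent of the
interval. -/
theorem volume_inter_Ioc_of_periodic {B : Set ℝ} (hB : MeasurableSet B) {p : ℝ} (hp : 0 < p)
    (hper : ∀ t, t + p ∈ B ↔ t ∈ B) (a b : ℝ) :
    volume (B ∩ Set.Ioc a (a + p)) = volume (B ∩ Set.Ioc b (b + p)) := by
  refine (isAddFundamentalDomain_Ioc hp a).measure_set_eq (isAddFundamentalDomain_Ioc hp b)
    hB fun g => ?_
  obtain ⟨_, m, rfl⟩ := g
  have hP : Function.Periodic (fun t => t ∈ B) p := fun t => propext (hper t)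
  ext t
  change m • p + t ∈ B ↔ t ∈ B
  rw [add_comm]
  exact iff_of_eq (hP.zsmul m t)

/-- If a `2π`-periodic set has measure at most `s` in a period, then for every `t₀` the set of
`x ∈ [0, π]` for which neither `t₀ + x` nor `t₀ - x` lies in it has measure at least `π - s`. -/
theorem le_volume_symmetrization {B : Set ℝ} (hB : MeasurableSet B)
    (hper : ∀ t, t + 2 * Real.pi ∈ B ↔ t ∈ B) {s : ℝ} (hs : 0 ≤ s)
    (hvol : volume (B ∩ Set.Ioc (-Real.pi) Real.pi) ≤ ENNReal.ofReal s) (t₀ : ℝ) :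
    Real.pi - s ≤
      volume.real {x | x ∈ Set.Icc 0 Real.pi ∧ t₀ + x ∉ B ∧ t₀ - x ∉ B} := by
  set A := {x | x ∈ Set.Icc 0 Real.pi ∧ t₀ + x ∉ B ∧ t₀ - x ∉ B} with hAdef
  have hfinA : volume A ≠ ⊤ :=
    ((measure_mono (fun x hx => hx.1 : A ⊆ Set.Icc 0 Real.pi)).trans_lt measure_Icc_lt_top).ne
  set U := B ∩ Set.Ioc t₀ (t₀ + Real.pi) with hU
  set V := B ∩ Set.Ioo (t₀ - Real.pi) t₀ with hV
  have hUV : volume U + volume V ≤ ENNReal.ofReal s := by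
    rw [← measure_union (Set.disjoint_left.mpr fun x hx hx' => lt_asymm hx.2.1 hx'.2.2)
      (hB.inter measurableSet_Ioo)]
    have h1 := volume_inter_Ioc_of_periodic hB Real.two_pi_pos hper (t₀ - Real.pi) (-Real.pi)
    rw [show -Real.pi + 2 * Real.pi = Real.pi by ring,
      show t₀ - Real.pi + 2 * Real.pi = t₀ + Real.pi by ring] at h1
    refine (measure_mono ?_).trans (h1.trans_le hvol)
    rintro x (⟨hx, h2, h3⟩ | ⟨hx, h2, h3⟩)
    · exact ⟨hx, by linarith [Real.pi_pos], h3⟩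
    · exact ⟨hx, h2, by linarith [Real.pi_pos]⟩
  have hcover : Set.Ioo 0 Real.pi ⊆
      A ∪ ((fun x => t₀ + x) ⁻¹' U ∪ (fun x => t₀ - x) ⁻¹' V) := by
    intro x hx
    by_cases h1 : t₀ + x ∈ B
    · exact Or.inr (Or.inl ⟨h1, by linarith [hx.1], by linarith [hx.2]⟩)
    by_cases h2 : t₀ - x ∈ B
    · exact Or.inr (Or.inr ⟨h2, by linarith [hx.2], by linarith [hx.1]⟩)
    exact Or.inl ⟨⟨hx.1.le, hx.2.le⟩, h1, h2⟩
  have hle : ENNReal.ofReal Real.pi ≤ volume A + ENNReal.ofReal s :=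
    calc ENNReal.ofReal Real.pi = volume (Set.Ioo 0 Real.pi) := by simp
      _ ≤ volume A + (volume ((fun x => t₀ + x) ⁻¹' U) + volume ((fun x => t₀ - x) ⁻¹' V)) :=
        (measure_mono hcover).trans ((measure_union_le _ _).trans
          (add_le_add le_rfl (measure_union_le _ _)))
      _ = volume A + (volume U + volume V) := by
        rw [measure_preimage_add, (Measure.measurePreserving_sub_left volume t₀).measure_preimage
          (hB.inter measurableSet_Ioo).nullMeasurableSet]
      _ ≤ volume A + ENNReal.ofReal s := add_le_add le_rfl hUV
  have := ENNReal.toReal_mono (ENNReal.add_ne_top.mpr ⟨hfinA, ENNReal.ofReal_ne_top⟩) hle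
  rw [ENNReal.toReal_add hfinA ENNReal.ofReal_ne_top, ENNReal.toReal_ofReal Real.pi_pos.le,
    ENNReal.toReal_ofReal hs] at this
  exact sub_le_iff_le_add.mpr this

theorem continuous_of_mem_complexTrigPoly {n : ℕ} {R : ℝ → ℂ} (hR : R ∈ complexTrigPoly n) :
    Continuous R := by
  obtain ⟨c, hc⟩ := hR
  rw [funext hc]
  fun_prop

theorem periodic_of_mem_complexTrigPoly {n : ℕ} {R : ℝ → ℂ} (hR : R ∈ complexTrigPoly n) :
    Function.Periodic R (2 * Real.pi) := by
  obtain ⟨c, hc⟩ := hR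
  intro t
  rw [hc, hc]
  refine Finset.sum_congr rfl fun k _ => congrArg _ ?_
  rw [← Complex.exp_periodic.int_mul k ((k : ℂ) * (t : ℂ) * Complex.I)]
  congr 1
  push_cast
  ring

open Polynomial Polynomial.Chebyshev in
/-- The even part of a trigonometric polynomial about any point is a polynomial in the cosine. -/
theorem exists_polynomial_eval_cos {n : ℕ} {R : ℝ → ℂ} (hR : R ∈ complexTrigPoly n) (t₀ : ℝ) :
    ∃ P : ℂ[X], P.degree ≤ n ∧
      ∀ x : ℝ, P.eval (Real.cos x : ℂ) = (R (t₀ + x) + R (t₀ - x)) / 2 := by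
  obtain ⟨c, hc⟩ := hR
  refine ⟨∑ k ∈ Finset.Icc (-(n : ℤ)) n, C (c k * Complex.exp (k * t₀ * Complex.I)) * T ℂ k,
    ?_, fun x => ?_⟩
  · refine (degree_sum_le _ _).trans (Finset.sup_le fun k hk => ?_)
    rw [← smul_eq_C_mul]
    refine (degree_smul_le _ _).trans ?_
    rw [degree_T]
    rw [Finset.mem_Icc] at hk
    exact_mod_cast (show k.natAbs ≤ n by omega)
  · rw [hc, hc, eval_finsetSum, ← Finset.sum_add_distrib, Finset.sum_div]
    refine Finset.sum_congr rfl fun k _ => ?_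
    rw [eval_mul, eval_C, Complex.ofReal_cos, T_complex_cos, Complex.cos]
    push_cast
    rw [show (k : ℂ) * (t₀ + x) * Complex.I = k * t₀ * Complex.I + k * x * Complex.I by ring,
      show (k : ℂ) * (t₀ - x) * Complex.I = k * t₀ * Complex.I + -(k * x) * Complex.I by ring,
      Complex.exp_add, Complex.exp_add]
    ring

open Polynomial.Chebyshev in
theorem eval_T_two_mul {R : Type*} [CommRing R] (n : ℤ) (x : R) :
    (T R (2 * n)).eval x = (T R n).eval (2 * x ^ 2 - 1) := by
  rw [mul_comm, T_mul, Polynomial.eval_comp, T_two]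
  simp

open Polynomial.Chebyshev in
/-- The bound of the Remez inequality, at an arbitrary point. -/
theorem norm_le_of_mem_complexTrigPolyRemez {n : ℕ} {s : ℝ} (hs : s ∈ Set.Ioo 0 Real.pi)
    {R : ℝ → ℂ} (hR : R ∈ complexTrigPolyRemez n s) (t₀ : ℝ) :
    ‖R t₀‖ ≤ (T ℝ (2 * (n : ℤ))).eval (realSec (s / 2)) := by
  obtain ⟨hR, hvol⟩ := hR
  have hcont := continuous_of_mem_complexTrigPoly hR
  have hper := periodic_of_mem_complexTrigPoly hR
  obtain ⟨P, hPdeg, hP⟩ := exists_polynomial_eval_cos hR t₀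
  set B : Set ℝ := {t | 1 < ‖R t‖} with hBdef
  have hBo : IsOpen B := isOpen_lt continuous_const hcont.norm
  have hBvol : volume (B ∩ Set.Ioc (-Real.pi) Real.pi) ≤ ENNReal.ofReal s := by
    set E : Set ℝ := {t | t ∈ Set.Icc (-Real.pi) Real.pi ∧ ‖R t‖ ≤ 1} with hE
    have hdisj : Disjoint E (B ∩ Set.Ioc (-Real.pi) Real.pi) :=
      Set.disjoint_left.mpr fun t ht ht' => not_lt.mpr ht.2 ht'.1
    have hsub : E ∪ (B ∩ Set.Ioc (-Real.pi) Real.pi) ⊆ Set.Icc (-Real.pi) Real.pi :=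
      Set.union_subset (fun t ht => ht.1) fun t ht => Set.Ioc_subset_Icc_self ht.2
    have h1 := measure_mono (μ := volume) hsub
    rw [measure_union hdisj (hBo.measurableSet.inter measurableSet_Ioc), Real.volume_Icc,
      show Real.pi - -Real.pi = (2 * Real.pi - s) + s by ring,
      ENNReal.ofReal_add (by linarith [hs.2, Real.pi_pos]) hs.1.le] at h1
    exact (ENNReal.add_le_add_iff_left ENNReal.ofReal_ne_top).mp
      ((add_le_add hvol le_rfl).trans h1)
  have hsym := le_volume_symmetrization hBo.measurableSet
    (fun t => by simp only [hBdef, Set.mem_ofPred_eq, hper t]) hs.1.le hBvol t₀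
  have hclosed : IsClosed {x | x ∈ Set.Icc 0 Real.pi ∧ t₀ + x ∉ B ∧ t₀ - x ∉ B} :=
    isClosed_Icc.inter ((hBo.isClosed_compl.preimage (by fun_prop)).inter
      (hBo.isClosed_compl.preimage (by fun_prop)))
  have hmain := norm_eval_one_le_of_measure hPdeg hclosed (fun x hx => hx.1) hs hsym
    fun x hx => by
      have h1 : ‖R (t₀ + x)‖ ≤ 1 := not_lt.mp hx.2.1
      have h2 : ‖R (t₀ - x)‖ ≤ 1 := not_lt.mp hx.2.2
      rw [hP, norm_div, Complex.norm_two]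
      linarith [norm_add_le (R (t₀ + x)) (R (t₀ - x))]
  have h0 := hP 0
  rw [Real.cos_zero, Complex.ofReal_one, add_zero, sub_zero, add_self_div_two] at h0
  rw [eval_T_two_mul, ← h0]
  exact hmain

-- When `a * b = 1`, the sequence `a ^ n + b ^ n` satisfies the Chebyshev recurrence with `2x = a +
-- b`; secant plus and minus tangent form such a pair.
open Polynomial.Chebyshev in
theorem eval_T_eq_of_mul_eq_one {n : ℕ} {a b : ℝ} (hab : a * b = 1) :
    (T ℝ n).eval ((a + b) / 2) = (a ^ n + b ^ n) / 2 := by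
  induction n using Nat.twoStepInduction with
  | zero => simp
  | one => simp
  | more n ih1 ih2 =>
    push_cast at ih1 ih2 ⊢
    rw [T_add_two]
    simp only [Polynomial.eval_sub, Polynomial.eval_mul, Polynomial.eval_X,
      Polynomial.eval_ofNat, ih1, ih2]
    linear_combination (-(a ^ n + b ^ n) / 2 + (a ^ n + b ^ n)) * hab

theorem theorem2p3 (n : ℕ) (s : ℝ) (hs : s ∈ Set.Ioo 0 Real.pi)
    (R : ℝ → ℂ) (hR : R ∈ complexTrigPolyRemez n s) :
    (∃ M : ℝ, IsGreatest (Set.range fun t : ℝ => ‖R t‖) M ∧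
      M ≤ (Polynomial.Chebyshev.T ℝ (2 * (n : ℤ))).eval (realSec (s / 2))) ∧
    (Polynomial.Chebyshev.T ℝ (2 * (n : ℤ))).eval (realSec (s / 2)) =
      1 / 2 * ((realSec (s / 2) + Real.tan (s / 2)) ^ (2 * n) +
        (realSec (s / 2) - Real.tan (s / 2)) ^ (2 * n)) := by
  constructor
  · have hcont := continuous_of_mem_complexTrigPoly hR.1
    have hper := periodic_of_mem_complexTrigPoly hR.1
    obtain ⟨t₀, -, hmax⟩ := (isCompact_Icc (a := 0) (b := 2 * Real.pi)).exists_isMaxOn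
      (Set.nonempty_Icc.mpr Real.two_pi_pos.le) hcont.norm.continuousOn
    refine ⟨‖R t₀‖, ⟨⟨t₀, rfl⟩, ?_⟩, norm_le_of_mem_complexTrigPolyRemez hs hR t₀⟩
    rintro _ ⟨t, rfl⟩
    obtain ⟨u, hu, htu⟩ := hper.exists_mem_Ico₀ Real.two_pi_pos t
    simp only [htu]
    exact hmax (Set.Ico_subset_Icc_self hu)
  · have hc : Real.cos (s / 2) ≠ 0 :=
      (Real.cos_pos_of_mem_Ioo ⟨by linarith [hs.1, Real.pi_pos], by linarith [hs.2]⟩).ne'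
    have hab : (realSec (s / 2) + Real.tan (s / 2)) * (realSec (s / 2) - Real.tan (s / 2)) = 1 := by
      rw [realSec, Real.tan_eq_sin_div_cos]
      field_simp
      linarith [Real.sin_sq_add_cos_sq (s / 2)]
    have h := eval_T_eq_of_mul_eq_one (n := 2 * n) hab
    rw [show (realSec (s / 2) + Real.tan (s / 2) + (realSec (s / 2) - Real.tan (s / 2))) / 2 =
      realSec (s / 2) by ring] at h
    push_cast at h
    rw [h]
    ring
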